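/- Let $\mathbf G$ be a locally compact, second countable, Hausdorff topological group with Borel $\sigma$-algebra and left Haar measure $\lambda$. Let $\mathbf X$ and $\mathbf Y$ be topological spaces whose Borel $\sigma$-algebras are standard Borel, and let $\mathbf G$ act continuously on each of them. Assume that the action on $\mathbf X$ is proper: there is a strictly positive measurable $h:\mathbf X\to(0,\infty)$ with $\int_{\mathbf G}h(gx)\,\lambda(dg)<\infty$ for every $x\in\mathbf X$. Let $P_{X,Y}$ be a probability measure on $\mathbf X\times\mathbf Y$ with first marginal $P_X$, and let $(X,Y)\sim P_{X,Y}$. "$P_X$-measurable" means measurable with respect to the $P_X$-completion of the Borel $\sigma$-algebra. Let * $\rho:\mathbf X\to\mathbf X$ be a $P_X$-measurable orbit selector: $\rho(x)$ lies in the orbit of $x$, and $\rho(gx)=\rho(x)$ for all $g\in\mathbf G$, $x\in\mathbf X$; * $P_{\tilde\tau|X}$ be an inversion kernel for $\rho$: a $P_X$-measurable family of probability measures $P_{\tilde\tau|X}(\cdot\mid x)$ on $\mathbf G$, $x\in\mathbf X$, such that $P_{\tilde\tau|X}(B\mid gx)=P_{\tilde\tau|X}(g^{-1}B\mid x)$ for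 all $g\in\mathbf G$, $x\in\mathbf X$ and Borel $B\subseteq\mathbf G$, and such that for every $x$, $\tilde\tau\rho(x)=x$ almost surely when $\tilde\tau\sim P_{\tilde\tau|X}(\cdot\mid x)$. Sample $\tilde\tau\sim P_{\tilde\tau|X}(\cdot\mid X)$ conditionally independently of $Y$ given $X$, and put $\tilde Y=\tilde\tau^{-1}Y$. Let $P_{\tilde Y|\rho(X)}$ and $P_{X|\rho(X)}$ be the regular conditional distributions of $\tilde Y$ and of $X$ given $\rho(X)$, and define the group-orbit kernel $$P_{\Gamma|\rho(X)}(\cdot\mid r)=\int_{\mathbf X}P_{\tilde\tau|X}(\cdot\mid x')\,P_{X|\rho(X)}(dx'\mid r).$$ Say that $P_{Y|X}$ is $\mathbf G$-equivariant if the conditional distribution of $Y$ given $X$ has a version, that is, a Markov kernel $P_{Y|X}$ with $P_{X,Y}=P_X\otimes P_{Y|X}$, such that $P_{Y|X}(B\mid x)=P_{Y|X}(gB\mid gx)$ for all $x\in\mathbf X$, $g\in\mathbf G$ and Borel $B\subseteq\mathbf Y$. Then $\mathbf G$-equivariance of $P_{Y|X}$ is equivalent to each one of the following three identities in distribution: *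 **(E1)** $(\rho(X),\tilde Y,X,Y)\overset{d}{=}(\rho(X),\tilde Y,\Gamma\rho(X),\Gamma\tilde Y)$, where $\tilde Y=\tilde\tau^{-1}Y$ and $\Gamma\sim P_{\Gamma|\rho(X)}(\cdot\mid\rho(X))$ is sampled conditionally independently of $(X,\tilde\tau,Y)$ given $\rho(X)$; * **(E2)** $(\rho(X),\tilde\tau,X,Y)\overset{d}{=}(\rho(X),\tilde\tau,\tilde\tau\rho(X),\tilde\tau\tilde Y')$, where $\tilde Y'\sim P_{\tilde Y|\rho(X)}(\cdot\mid\rho(X))$ is sampled conditionally independently of $(X,\tilde\tau,Y)$ given $\rho(X)$; * **(E3)** $(\rho(X),X,Y)\overset{d}{=}(\rho(X),\Gamma\rho(X),\Gamma\tilde Y')$, where $\Gamma\sim P_{\Gamma|\rho(X)}(\cdot\mid\rho(X))$ and $\tilde Y'\sim P_{\tilde Y|\rho(X)}(\cdot\mid\rho(X))$ are sampled conditionally independently of each other given $\rho(X)$. -/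

import Mathlib

open MeasureTheory ProbabilityTheory
open scoped Pointwise NNReal ENNReal

/-- A proper action in the measure-theoretic sense: some strictly positive measurable function has
finite integral, with respect to left Haar measure, along every orbit. -/
def IsProperAction (G X : Type*) [Group G] [TopologicalSpace G] [IsTopologicalGroup G]
    [LocallyCompactSpace G] [MeasurableSpace G] [BorelSpace G] [MeasurableSpace X]
    [MulAction G X] : Prop :=
  ∃ h : X → ℝ≥0, Measurable h ∧ (∀ x, 0 < h x) ∧
    ∀ x, ∫⁻ g : G, (h (g • x) : ℝ≥0∞) ∂(Measure.haar : Measure G) < ∞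

/-- `ρ` sends every point to a representative of its orbit, the same one along each orbit. -/
structure IsOrbitSelector (G : Type*) {X : Type*} [Group G] [MulAction G X] (ρ : X → X) :
    Prop where
  mem_orbit : ∀ x, ρ x ∈ MulAction.orbit G x
  smul_eq : ∀ (g : G) (x : X), ρ (g • x) = ρ x

/-- `K` is an inversion probability kernel for the orbit selector `ρ`, measurable with respect to
the completion of the Borel sets under `PX`: it is equivariant, and `t ∼ K x` satisfies
`t • ρ x = x` almost surely. (These properties force `K (ρ x)` to be the left-invariant probability
measure on the stabilizer of `ρ x`, and so determine `K`.) -/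
structure IsInversionKernel {G X : Type*} [Group G] [MeasurableSpace G] [MeasurableSpace X]
    [MulAction G X] (PX : Measure X) (ρ : X → X) (K : X → Measure G)
    [∀ x, IsProbabilityMeasure (K x)] : Prop where
  aemeasurable : AEMeasurable K PX
  equivariant : ∀ (g : G) (x : X) (B : Set G), MeasurableSet B → K (g • x) B = K x (g⁻¹ • B)
  inversion : ∀ x, ∀ᵐ t ∂(K x), t • ρ x = x

/-- Equivariance of a Markov kernel, at every point. -/
def IsEquivariantKernel (G : Type*) {X Y : Type*} [Group G] [MeasurableSpace X]
    [MeasurableSpace Y] [MulAction G X] [MulAction G Y] (κ : Kernel X Y) : Prop :=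
  ∀ (g : G) (x : X) (B : Set Y), MeasurableSet B → κ x B = κ (g • x) (g • B)

/-- The conditional distribution of `Y` given `X`, for `(X, Y) ∼ P`, is equivariant: since it is
determined only up to a null set, this says that it has an equivariant version. -/
def IsEquivariantCondDistrib (G : Type*) {X Y : Type*} [Group G] [MeasurableSpace X]
    [MeasurableSpace Y] [MulAction G X] [MulAction G Y] (P : Measure (X × Y)) : Prop :=
  ∃ κ : Kernel X Y, IsMarkovKernel κ ∧ P = P.fst ⊗ₘ κ ∧ IsEquivariantKernel G κ

noncomputable section

/-- The law of `(X, T, Y)`, where `(X, Y) ∼ P` and `T` is sampled from `K X`, conditionally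
independently of `Y` given `X`. -/
def inversionLaw {G X Y : Type*} [MeasurableSpace G] [MeasurableSpace X] [MeasurableSpace Y]
    (P : Measure (X × Y)) (K : X → Measure G) : Measure (X × G × Y) :=
  P.bind fun p => (K p.1).map fun t => (p.1, t, p.2)

/-- The group-orbit kernel: the mixture of `K x'` over the conditional distribution of `x' = X`
given `ρ(X) = r`. -/
def groupOrbitKernel {G X : Type*} [MeasurableSpace G] [MeasurableSpace X] [StandardBorelSpace X]
    [Nonempty X] (PX : Measure X) [IsFiniteMeasure PX] (ρ : X → X) (K : X → Measure G) (r : X) :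
    Measure G :=
  (condDistrib (fun x : X => x) ρ PX r).bind K

instance inversionLaw.isFiniteMeasure {G X Y : Type*} [MeasurableSpace G] [MeasurableSpace X]
    [MeasurableSpace Y] (P : Measure (X × Y)) [IsProbabilityMeasure P] (K : X → Measure G)
    [∀ x, IsProbabilityMeasure (K x)] : IsFiniteMeasure (inversionLaw P K) := by
  refine ⟨lt_of_le_of_lt (Measure.bind_apply_le _ MeasurableSet.univ) ?_⟩
  refine lt_of_le_of_lt (lintegral_mono (g := fun _ => 1) fun p => ?_) (by simp)
  have h : Measurable fun t : G => (p.1, t, p.2) := by fun_prop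
  change ((K p.1).map fun t => (p.1, t, p.2)) Set.univ ≤ 1
  rw [Measure.map_apply h MeasurableSet.univ]
  exact prob_le_one

/-- The conditional distribution, given `ρ(X)`, of the centred variable `T⁻¹ • Y`, where
`(X, T, Y)` follows `inversionLaw P K`. -/
def centredKernel {G X Y : Type*} [Group G] [MeasurableSpace G] [MeasurableSpace X]
    [MeasurableSpace Y] [StandardBorelSpace Y] [Nonempty Y] [MulAction G Y]
    (P : Measure (X × Y)) [IsProbabilityMeasure P] (ρ : X → X) (K : X → Measure G)
    [∀ x, IsProbabilityMeasure (K x)] : Kernel X Y :=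
  condDistrib (fun ω : X × G × Y => ω.2.1⁻¹ • ω.2.2) (fun ω => ρ ω.1) (inversionLaw P K)

/-- The law of `(ρ(X), Ỹ, X, Y)` equals that of `(ρ(X), Ỹ, Γ • ρ(X), Γ • Ỹ)`, where `Ỹ = T⁻¹ • Y`
and `Γ` is sampled from the group-orbit kernel at `ρ(X)`, conditionally independently of the other
variables given `ρ(X)`. -/
def IdentityE1 {G X Y : Type*} [Group G] [MeasurableSpace G] [MeasurableSpace X]
    [MeasurableSpace Y] [StandardBorelSpace X] [Nonempty X] [MulAction G X] [MulAction G Y]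
    (P : Measure (X × Y)) [IsProbabilityMeasure P] (ρ : X → X) (K : X → Measure G) : Prop :=
  (inversionLaw P K).map (fun ω : X × G × Y => (ρ ω.1, ω.2.1⁻¹ • ω.2.2, ω.1, ω.2.2)) =
    (inversionLaw P K).bind fun ω =>
      (groupOrbitKernel P.fst ρ K (ρ ω.1)).map fun γ : G =>
        (ρ ω.1, ω.2.1⁻¹ • ω.2.2, γ • ρ ω.1, γ • (ω.2.1⁻¹ • ω.2.2))

/-- The law of `(ρ(X), T, X, Y)` equals that of `(ρ(X), T, T • ρ(X), T • Ỹ)`, where `Ỹ` is sampled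
from its conditional distribution given `ρ(X)`, conditionally independently of the other variables
given `ρ(X)`. -/
def IdentityE2 {G X Y : Type*} [Group G] [MeasurableSpace G] [MeasurableSpace X]
    [MeasurableSpace Y] [StandardBorelSpace Y] [Nonempty Y] [MulAction G X] [MulAction G Y]
    (P : Measure (X × Y)) [IsProbabilityMeasure P] (ρ : X → X) (K : X → Measure G)
    [∀ x, IsProbabilityMeasure (K x)] : Prop :=
  (inversionLaw P K).map (fun ω : X × G × Y => (ρ ω.1, ω.2.1, ω.1, ω.2.2)) =
    (inversionLaw P K).bind fun ω =>
      (centredKernel P ρ K (ρ ω.1)).map fun y : Y =>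
        (ρ ω.1, ω.2.1, ω.2.1 • ρ ω.1, ω.2.1 • y)

/-- The law of `(ρ(X), X, Y)` equals that of `(ρ(X), Γ • ρ(X), Γ • Ỹ)`, where `Γ` and `Ỹ` are both
sampled from their conditional distributions given `ρ(X)`, conditionally independently of each
other given `ρ(X)`. -/
def IdentityE3 {G X Y : Type*} [Group G] [MeasurableSpace G] [MeasurableSpace X]
    [MeasurableSpace Y] [StandardBorelSpace X] [Nonempty X] [StandardBorelSpace Y] [Nonempty Y]
    [MulAction G X] [MulAction G Y]
    (P : Measure (X × Y)) [IsProbabilityMeasure P] (ρ : X → X) (K : X → Measure G)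
    [∀ x, IsProbabilityMeasure (K x)] : Prop :=
  P.map (fun p : X × Y => (ρ p.1, p.1, p.2)) =
    P.fst.bind fun x =>
      ((groupOrbitKernel P.fst ρ K (ρ x)).prod (centredKernel P ρ K (ρ x))).map
        fun z : G × Y => (ρ x, z.1 • ρ x, z.1 • z.2)

end

/-!
Write `R = ρ(X)`, `T` for the sampled inversion and `Ỹ = T⁻¹ • Y`, so that `X = T • R` and
`Y = T • Ỹ` almost surely. Given `R`, the group-orbit kernel is the conditional law of `T`
(`compProd_map_selector`) and the centred kernel that of `Ỹ`. Let `J` be the law of `(R, Γ, Ỹ')` with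
`Γ` and `Ỹ'` drawn from these two kernels, conditionally independently given `R` (`orbitLaw`). The
right-hand side of each identity is the image of `J` under an explicit map, and the left-hand side is
the image of the law of `(R, T, Ỹ)` under the same map.

If `κ` is an equivariant version of the law of `Y` given `X`, then given `(X, T)` the variable `Ỹ`
has law `κ (T⁻¹ • X) = κ R`. Hence `T` and `Ỹ` are conditionally independent given `R`, which means
that `(R, T, Ỹ)` has law `J` (`inversionLaw_map_eq_orbitLaw`), and the first two identities follow.
Each of them projects to the third.

Conversely, the third identity says that given `X = x` the law of `Y` is
`κ' x = ∫ t • Q (ρ x) K x (dt)`, with `Q` the centred kernel (`eq_compProd_of_identityE3`). The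
family `κ'` is equivariant at every point, but it is measurable only for the completion of `P_X`,
and `P_X` need not be quasi-invariant, so altering it on a null set may destroy equivariance. A
Markov kernel is recovered in two steps. With `κ₀` a Borel version of `κ'` and `(g, x)` distributed
as Haar measure (made finite) times `P_X`, averaging `g • κ₀ x` over the conditional distribution of
`(g, x)` given `g • x = z` gives a Borel kernel `κ₁` that agrees with `κ'` along almost all of almost
every orbit (`exists_markovKernel_ae_eq_on_orbits`). Then, with `h` the integrable weight of the
proper action, the average of `g⁻¹ • κ₁ (g • x)` with density proportional to `h (g • x)` is Borel,
equivariant at every point, and equal to `κ' x` for almost every `x`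
(`exists_equivariantKernel_of_ae_on_orbits`).
-/

/-! ### Kernels and mixtures -/

theorem id_prod_map_apply {α β γ : Type*} [MeasurableSpace α] [MeasurableSpace β]
    [MeasurableSpace γ] (κ : Kernel α β) [IsSFiniteKernel κ] {f : α × β → γ} (hf : Measurable f)
    (a : α) : ((Kernel.id ×ₖ κ).map f) a = (κ a).map fun b => f (a, b) := by
  rw [Kernel.map_apply _ hf, Kernel.prod_apply, Kernel.id_apply, Measure.dirac_prod,
    Measure.map_map hf (by fun_prop)]
  rfl

theorem measurable_map_prodMk {α β γ : Type*} [MeasurableSpace α] [MeasurableSpace β]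
    [MeasurableSpace γ] (κ : Kernel α β) [IsSFiniteKernel κ] {f : α × β → γ}
    (hf : Measurable f) : Measurable fun a => (κ a).map fun b => f (a, b) := by
  simp only [← id_prod_map_apply κ hf]
  exact Kernel.measurable _

theorem bind_map_eq_map_compProd {α β γ : Type*} [MeasurableSpace α] [MeasurableSpace β]
    [MeasurableSpace γ] (μ : Measure α) [SFinite μ] (κ : Kernel α β) [IsSFiniteKernel κ]
    {f : α × β → γ} (hf : Measurable f) :
    (μ.bind fun a => (κ a).map fun b => f (a, b)) = (μ ⊗ₘ κ).map f := by
  simp only [← id_prod_map_apply κ hf]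
  rw [Measure.compProd_eq_comp_prod, Measure.map_comp _ _ hf]

theorem bind_comp_eq_bind_map {α β γ : Type*} [MeasurableSpace α] [MeasurableSpace β]
    [MeasurableSpace γ] {μ : Measure α} {u : α → β} (hu : AEMeasurable u μ)
    {m : β → Measure γ} (hm : Measurable m) :
    (μ.bind fun a => m (u a)) = (μ.map u).bind m := by
  ext s hs
  rw [Measure.bind_apply hs (show AEMeasurable (fun a => m (u a)) μ from hm.comp_aemeasurable hu), Measure.bind_apply hs hm.aemeasurable,
    lintegral_map' (f := fun b => m b s) ((Measure.measurable_coe hs).comp hm).aemeasurable hu]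

theorem lintegral_compProd_prod {α β γ : Type*} [MeasurableSpace α] [MeasurableSpace β]
    [MeasurableSpace γ] (η : Measure α) [SFinite η] (κ : Kernel α β) [IsSFiniteKernel κ]
    (θ : Kernel α γ) [IsSFiniteKernel θ] {f : α × β × γ → ℝ≥0∞} (hf : Measurable f) :
    ∫⁻ q, f q ∂(η ⊗ₘ (κ ×ₖ θ)) =
      ∫⁻ p, ∫⁻ y, f (p.1, p.2, y) ∂(θ p.1) ∂(η ⊗ₘ κ) := by
  have h1 : Measurable fun q : (α × β) × γ => f (q.1.1, q.1.2, q.2) := by fun_prop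
  have h2 : Measurable fun p : α × β => ∫⁻ y, f (p.1, p.2, y) ∂(θ p.1) :=
    h1.lintegral_kernel_prod_right' (κ := θ.comap Prod.fst measurable_fst)
  rw [Measure.lintegral_compProd hf, Measure.lintegral_compProd h2]
  refine lintegral_congr fun r => ?_
  rw [Kernel.lintegral_prod _ _ _ (by fun_prop)]

theorem compProd_prod_map_swap {α β γ : Type*} [MeasurableSpace α] [MeasurableSpace β]
    [MeasurableSpace γ] (η : Measure α) [SFinite η] (κ : Kernel α β) [IsSFiniteKernel κ]
    (θ : Kernel α γ) [IsSFiniteKernel θ] :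
    (η ⊗ₘ (θ ×ₖ κ)).map (Prod.map id Prod.swap) = η ⊗ₘ (κ ×ₖ θ) := by
  rw [← Measure.compProd_map measurable_swap, Kernel.map_prod_swap]

/-- Sampling from `θ r` given a pair `(r, b) ∼ η ⊗ κ` makes the new variable and `b` conditionally
independent given `r`. -/
theorem bind_resample {Ω α β γ δ : Type*} [MeasurableSpace Ω] [MeasurableSpace α]
    [MeasurableSpace β] [MeasurableSpace γ] [MeasurableSpace δ] {L : Measure Ω}
    {η : Measure α} [SFinite η] {κ : Kernel α β} [IsSFiniteKernel κ] {u : Ω → α × β}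
    (hu : AEMeasurable u L) (hL : L.map u = η ⊗ₘ κ) (θ : Kernel α γ) [IsSFiniteKernel θ]
    {F : α × β × γ → δ} (hF : Measurable F) :
    (L.bind fun ω => (θ (u ω).1).map fun c => F ((u ω).1, (u ω).2, c)) =
      (η ⊗ₘ (κ ×ₖ θ)).map F := by
  have hF' : Measurable fun q : (α × β) × γ => F (q.1.1, q.1.2, q.2) := by fun_prop
  have h1 := measurable_map_prodMk (θ.comap (Prod.fst : α × β → α) measurable_fst) hF'
  have h2 := bind_map_eq_map_compProd (η ⊗ₘ κ)
    (θ.comap (Prod.fst : α × β → α) measurable_fst) hF'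
  refine (bind_comp_eq_bind_map hu h1).trans ?_
  rw [hL, h2]
  refine Measure.ext_of_lintegral _ fun f hf => ?_
  rw [lintegral_map hf hF', lintegral_map hf hF, lintegral_compProd_prod (f := fun q => f (F q)) _ _ _ (by fun_prop),
    Measure.lintegral_compProd (by fun_prop)]
  rfl

/-! ### Equivariant versions of almost everywhere measurable kernels -/

/-- A locally compact Hausdorff group is complete for its right uniformity, which is metrizable
when the group is second countable. -/
theorem polishSpace_of_locallyCompact_group (G : Type*) [Group G] [TopologicalSpace G]
    [IsTopologicalGroup G] [LocallyCompactSpace G] [SecondCountableTopology G] [T2Space G] :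
    PolishSpace G := by
  let _ : UniformSpace G := IsTopologicalGroup.rightUniformSpace G
  have : IsRightUniformGroup G := { ‹IsTopologicalGroup G› with uniformity_eq := rfl }
  have : CompleteSpace G := IsRightUniformGroup.completeSpace_of_weaklyLocallyCompactSpace
  have : (uniformity G).IsCountablyGenerated := by
    rw [uniformity_eq_comap_nhds_one' G]
    infer_instance
  infer_instance

/-- The condition of having total mass one is measurable, so that an almost everywhere measurable
family of probability measures agrees almost everywhere with a Markov kernel. -/
theorem exists_markovKernel_ae_eq {X Z : Type*} [MeasurableSpace X] [MeasurableSpace Z]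
    [Nonempty X] {μ : Measure X} {K : X → Measure Z} [∀ x, IsProbabilityMeasure (K x)]
    (hK : AEMeasurable K μ) :
    ∃ κ : Kernel X Z, IsMarkovKernel κ ∧ ∀ᵐ x ∂μ, κ x = K x := by
  classical
  obtain ⟨K', hK', hKK'⟩ := hK
  obtain ⟨x₀⟩ := ‹Nonempty X›
  have hs : MeasurableSet {x | K' x Set.univ = 1} :=
    (Measure.measurable_coe MeasurableSet.univ).comp hK' (measurableSet_singleton 1)
  refine ⟨⟨fun x => if K' x Set.univ = 1 then K' x else K x₀,
    Measurable.ite hs hK' measurable_const⟩, ⟨fun x => ?_⟩, ?_⟩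
  · change IsProbabilityMeasure (if K' x Set.univ = 1 then K' x else K x₀)
    split_ifs with h
    · exact ⟨h⟩
    · infer_instance
  · filter_upwards [hKK'] with x hx
    change (if K' x Set.univ = 1 then K' x else K x₀) = K x
    rw [if_pos (by rw [← hx]; exact measure_univ), hx]

/-- If `κ'` is equivariant at every point and agrees `μ`-almost everywhere with the Markov kernel
`κ₀`, then some Markov kernel agrees with `κ'` at `g • x` for `μ`-almost every `x` and `ν`-almost
every `g`. Draw `x` from `μ` and `g` independently from a finite measure equivalent to `ν`: given
`g • x = z`, almost surely `g • κ₀ x = g • κ' x = κ' z`, so the average of `g • κ₀ x` over the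
conditional distribution of `(g, x)` given `g • x = z` is such a kernel. -/
theorem exists_markovKernel_ae_eq_on_orbits {G X Y : Type*}
    [Group G] [MeasurableSpace G] [StandardBorelSpace G]
    [MeasurableSpace X] [StandardBorelSpace X] [Nonempty X]
    [MeasurableSpace Y]
    [MulAction G X] [MeasurableSMul₂ G X] [MulAction G Y] [MeasurableSMul₂ G Y]
    (ν : Measure G) [SFinite ν] {μ : Measure X} [IsFiniteMeasure μ]
    {κ' : X → Measure Y} (κ₀ : Kernel X Y) [IsMarkovKernel κ₀] (hκ₀ : ∀ᵐ x ∂μ, κ₀ x = κ' x)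
    (heq : ∀ (g : G) x, κ' (g • x) = (κ' x).map (g • ·)) :
    ∃ κ : Kernel X Y, IsMarkovKernel κ ∧ ∀ᵐ x ∂μ, ∀ᵐ g ∂ν, κ (g • x) = κ' (g • x) := by
  have hact : Measurable fun p : X × G => p.2 • p.1 := measurable_snd.smul measurable_fst
  have hact' : Measurable fun q : (X × G) × Y => q.1.2 • q.2 :=
    (measurable_snd.comp measurable_fst).smul measurable_snd
  let θ : Kernel (X × G) Y :=
    (Kernel.id ×ₖ κ₀.comap Prod.fst measurable_fst).map
      fun q : (X × G) × Y => q.1.2 • q.2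
  have : IsMarkovKernel θ := Kernel.IsMarkovKernel.map _ hact'
  have hθ : ∀ x g, θ (x, g) = (κ₀ x).map (g • ·) := by
    intro x g
    rw [id_prod_map_apply _ hact', Kernel.comap_apply]
  let M : Measure (X × G) := μ.prod ν.toFinite
  let D : Kernel X (X × G) := condDistrib id (fun p : X × G => p.2 • p.1) M
  refine ⟨θ ∘ₖ D, inferInstance, ?_⟩
  -- Under the joint law of `(g • x, (x, g))` both properties hold almost surely, hence they hold
  -- under almost every conditional distribution.
  have hjoint : ∀ᵐ q ∂((M.map fun p : X × G => p.2 • p.1) ⊗ₘ D),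
      q.2.2 • q.2.1 = q.1 ∧ κ₀ q.2.1 = κ' q.2.1 := by
    rw [compProd_map_condDistrib measurable_id.aemeasurable]
    have hm : Measurable fun p : X × G => (p.2 • p.1, id p) := hact.prodMk measurable_id
    refine Filter.Eventually.and ?_ ?_
    · rw [ae_map_iff hm.aemeasurable]
      · exact Filter.Eventually.of_forall fun _ => rfl
      · exact measurableSet_eq_fun (by fun_prop) measurable_fst
    · have h1 : ∀ᵐ p ∂M, κ₀ p.1 = κ' p.1 := Measure.quasiMeasurePreserving_fst.ae hκ₀
      refine ae_of_ae_map (f := fun q : X × X × G => q.2) (by fun_prop) ?_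
        (p := fun p : X × G => κ₀ p.1 = κ' p.1)
      rw [Measure.map_map measurable_snd hm]
      change ∀ᵐ p ∂(M.map id), κ₀ p.1 = κ' p.1
      rwa [Measure.map_id]
  have hz : ∀ᵐ z ∂(M.map fun p : X × G => p.2 • p.1), (θ ∘ₖ D) z = κ' z := by
    filter_upwards [Measure.ae_ae_of_ae_compProd hjoint] with z hz
    ext B hB
    rw [Kernel.comp_apply' _ _ _ hB]
    have : ∀ᵐ p ∂D z, θ p B = κ' z B := by
      filter_upwards [hz] with p hp
      obtain ⟨x, g⟩ := p
      rw [hθ, hp.2, ← heq, hp.1]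
    rw [lintegral_congr_ae this]
    simp
  have h2 := Measure.ae_ae_of_ae_prod (ae_of_ae_map hact.aemeasurable hz)
  filter_upwards [h2] with x hx
  rwa [ae_toFinite] at hx

/-- Right translation multiplies left Haar integrals by the modular character. -/
theorem lintegral_mul_right_haar {G : Type*} [Group G] [TopologicalSpace G]
    [IsTopologicalGroup G] [LocallyCompactSpace G] [SecondCountableTopology G] [T2Space G]
    [MeasurableSpace G] [BorelSpace G] (f : G → ℝ≥0∞) (hf : Measurable f) (k : G) :
    ∫⁻ g, f (g * k) ∂(Measure.haar : Measure G) =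
      (Measure.modularCharacterFun k : ℝ≥0∞) * ∫⁻ g, f g ∂(Measure.haar : Measure G) := by
  rw [← lintegral_map hf (measurable_mul_const k),
    Measure.map_right_mul_eq_modularCharacterFun_smul, lintegral_smul_measure]
  rfl

/-- Averaging over orbits. For a proper action with weight `h`, the kernel
`κ x = Z(x)⁻¹ ∫ h (g • x) • g⁻¹ κ₁ (g • x) dg`, with `Z` the normalizing integral, is equivariant
at every point, because the modular character produced by a right translation cancels in the
quotient. At a point whose orbit meets `{κ₁ ≠ κ'}` in a null set it equals `κ'`, as `κ'` is
equivariant. -/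
theorem exists_equivariantKernel_of_ae_on_orbits {G X Y : Type*}
    [Group G] [TopologicalSpace G] [IsTopologicalGroup G] [LocallyCompactSpace G]
    [SecondCountableTopology G] [T2Space G] [MeasurableSpace G] [BorelSpace G]
    [MeasurableSpace X] [MeasurableSpace Y]
    [MulAction G X] [MeasurableSMul₂ G X] [MulAction G Y] [MeasurableSMul₂ G Y]
    (hproper : IsProperAction G X) {κ' : X → Measure Y}
    (heq : ∀ (g : G) x, κ' (g • x) = (κ' x).map (g • ·))
    (κ₁ : Kernel X Y) [IsMarkovKernel κ₁] :
    ∃ κ : Kernel X Y, IsMarkovKernel κ ∧ IsEquivariantKernel G κ ∧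
      ∀ x, (∀ᵐ g ∂(Measure.haar : Measure G), κ₁ (g • x) = κ' (g • x)) → κ x = κ' x := by
  obtain ⟨h, hh, hpos, hfin⟩ := hproper
  let m : Measure G := Measure.haar
  let Z : X → ℝ≥0∞ := fun x => ∫⁻ g, h (g • x) ∂m
  have hhm : Measurable fun p : X × G => (h (p.2 • p.1) : ℝ≥0∞) :=
    (hh.comp (measurable_snd.smul measurable_fst)).coe_nnreal_ennreal
  have hhx : ∀ x, Measurable fun g : G => (h (g • x) : ℝ≥0∞) :=
    fun _ => hhm.comp measurable_prodMk_left
  have hZm : Measurable Z := hhm.lintegral_prod_right'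
  have hZtop : ∀ x, Z x ≠ ∞ := fun x => (hfin x).ne
  have hZ0 : ∀ x, Z x ≠ 0 := by
    intro x hx
    have hx := (lintegral_eq_zero_iff (hhx x)).1 hx
    have : ∀ᵐ g ∂m, False := by
      filter_upwards [hx] with g hg
      exact (hpos (g • x)).ne' (by simpa using hg)
    have hm0 : m = 0 := by simpa using this
    exact (NeZero.ne m) hm0
  let w : X → G → ℝ≥0∞ := fun x g => h (g • x) * (Z x)⁻¹
  have hw : Measurable (Function.uncurry w) := hhm.mul (hZm.comp measurable_fst).inv
  have hwx : ∀ x, Measurable (w x) := fun _ => hw.comp measurable_prodMk_left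
  let N : Kernel X G := (Kernel.const X m).withDensity w
  have hN : ∀ x (f : G → ℝ≥0∞), Measurable f → ∫⁻ g, f g ∂(N x) = ∫⁻ g, w x g * f g ∂m := by
    intro x f hf
    rw [Kernel.lintegral_withDensity _ hw _ hf, Kernel.const_apply]
  have : IsMarkovKernel N := by
    refine ⟨fun x => ⟨?_⟩⟩
    rw [← lintegral_one, hN x _ measurable_const]
    simp only [mul_one, w]
    rw [lintegral_mul_const _ (hhx x)]
    exact ENNReal.mul_inv_cancel (hZ0 x) (hZtop x)
  have hact : Measurable fun p : X × G => p.2 • p.1 := measurable_snd.smul measurable_fst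
  have hact' : Measurable fun q : (X × G) × Y => q.1.2⁻¹ • q.2 :=
    (measurable_snd.comp measurable_fst).inv.smul measurable_snd
  let θ : Kernel (X × G) Y :=
    (Kernel.id ×ₖ κ₁.comap (fun p : X × G => p.2 • p.1) hact).map
      fun q : (X × G) × Y => q.1.2⁻¹ • q.2
  have : IsMarkovKernel θ := Kernel.IsMarkovKernel.map _ hact'
  have hθ : ∀ x g, θ (x, g) = (κ₁ (g • x)).map (g⁻¹ • ·) := by
    intro x g
    rw [id_prod_map_apply _ hact', Kernel.comap_apply]
  let κ : Kernel X Y := (N ⊗ₖ θ).map Prod.snd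
  have hκ : ∀ x (B : Set Y), MeasurableSet B →
      κ x B = ∫⁻ g, w x g * κ₁ (g • x) (g • B) ∂m := by
    intro x B hB
    rw [Kernel.map_apply' _ measurable_snd _ hB, Kernel.compProd_apply (measurable_snd hB)]
    refine (hN x (fun g => θ (x, g) B) ((Kernel.measurable_coe θ hB).comp measurable_prodMk_left)).trans ?_
    refine lintegral_congr fun g => ?_
    congr 1
    rw [hθ, Measure.map_apply (measurable_const_smul _) hB, Set.preimage_smul, inv_inv]
  have hκm : ∀ x (B : Set Y), MeasurableSet B →
      Measurable fun g : G => w x g * κ₁ (g • x) (g • B) := by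
    intro x B hB
    refine (hwx x).mul ?_
    have : Measurable fun g => θ (x, g) B :=
      (Kernel.measurable_coe θ hB).comp measurable_prodMk_left
    convert this using 2 with g
    rw [hθ, Measure.map_apply (measurable_const_smul _) hB, Set.preimage_smul, inv_inv]
  refine ⟨κ, Kernel.IsMarkovKernel.map _ measurable_snd, ?_, ?_⟩
  · intro k x B hB
    have hΔ0 : (Measure.modularCharacterFun k : ℝ≥0∞) ≠ 0 := by
      exact_mod_cast (Measure.modularCharacterFun_pos k).ne'
    have hZk : Z (k • x) = Measure.modularCharacterFun k * Z x := by
      change ∫⁻ g, (h (g • k • x) : ℝ≥0∞) ∂m = _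
      simp only [smul_smul]
      exact lintegral_mul_right_haar (fun g => (h (g • x) : ℝ≥0∞))
        (hhx x) k
    have hwk : ∀ g, w (k • x) g = (Measure.modularCharacterFun k : ℝ≥0∞)⁻¹ * w x (g * k) := by
      intro g
      simp only [w, hZk, smul_smul]
      rw [ENNReal.mul_inv (Or.inl hΔ0) (Or.inl ENNReal.coe_ne_top)]
      ring
    rw [hκ x B hB, hκ (k • x) (k • B) (hB.const_smul k)]
    simp only [hwk, smul_smul, mul_assoc]
    have hmeas := hκm x B hB
    rw [lintegral_const_mul' _ _ (ENNReal.inv_ne_top.2 hΔ0),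
      lintegral_mul_right_haar (fun g => w x g * κ₁ (g • x) (g • B)) hmeas k, ← mul_assoc,
      ENNReal.inv_mul_cancel hΔ0 ENNReal.coe_ne_top, one_mul]
  · intro x hx
    ext B hB
    rw [hκ x B hB]
    have : ∀ᵐ g ∂m, w x g * κ₁ (g • x) (g • B) = w x g * κ' x B := by
      filter_upwards [hx] with g hg
      rw [hg, heq, Measure.map_apply (measurable_const_smul g) (hB.const_smul g),
        Set.preimage_smul, inv_smul_smul]
    rw [lintegral_congr_ae this, lintegral_mul_const _ (hwx x)]
    have h1 := hN x (fun _ => 1) measurable_const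
    simp only [mul_one, lintegral_one, measure_univ] at h1
    rw [← h1, one_mul]

/-- For a proper action, an almost everywhere measurable family of probability measures that is
equivariant at every point has a Markov kernel as a version that is still equivariant at every
point. -/
theorem exists_equivariantKernel_ae_eq {G X Y : Type*}
    [Group G] [TopologicalSpace G] [IsTopologicalGroup G] [LocallyCompactSpace G]
    [SecondCountableTopology G] [T2Space G] [MeasurableSpace G] [BorelSpace G]
    [MeasurableSpace X] [StandardBorelSpace X] [Nonempty X] [MeasurableSpace Y]
    [MulAction G X] [MeasurableSMul₂ G X] [MulAction G Y] [MeasurableSMul₂ G Y]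
    (hproper : IsProperAction G X) {μ : Measure X} [IsFiniteMeasure μ]
    {κ' : X → Measure Y} [∀ x, IsProbabilityMeasure (κ' x)] (hm : AEMeasurable κ' μ)
    (heq : ∀ (g : G) x, κ' (g • x) = (κ' x).map (g • ·)) :
    ∃ κ : Kernel X Y, IsMarkovKernel κ ∧ IsEquivariantKernel G κ ∧ ∀ᵐ x ∂μ, κ x = κ' x := by
  have := polishSpace_of_locallyCompact_group G
  obtain ⟨κ₀, _, hκ₀⟩ := exists_markovKernel_ae_eq hm
  obtain ⟨κ₁, _, hκ₁⟩ :=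
    exists_markovKernel_ae_eq_on_orbits (Measure.haar : Measure G) κ₀ hκ₀ heq
  obtain ⟨κ, hκM, hκe, hκ⟩ := exists_equivariantKernel_of_ae_on_orbits hproper heq κ₁
  exact ⟨κ, hκM, hκe, hκ₁.mono hκ⟩

/-! ### The law of `(X, T, Y)` -/

theorem lintegral_inversionLaw {G X Y : Type*} [MeasurableSpace G] [MeasurableSpace X]
    [MeasurableSpace Y] {P : Measure (X × Y)} [IsProbabilityMeasure P] {K : X → Measure G}
    {K' : Kernel X G} [IsMarkovKernel K'] (hK' : ∀ᵐ x ∂P.fst, K' x = K x)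
    {f : X × G × Y → ℝ≥0∞} (hf : Measurable f) :
    ∫⁻ ω, f ω ∂(inversionLaw P K) = ∫⁻ p, ∫⁻ t, f (p.1, t, p.2) ∂(K' p.1) ∂P := by
  have hF : Measurable fun q : (X × Y) × G => (q.1.1, q.2, q.1.2) := by fun_prop
  have h1 : inversionLaw P K =
      (P ⊗ₘ K'.comap Prod.fst measurable_fst).map fun q : (X × Y) × G => (q.1.1, q.2, q.1.2) := by
    rw [← bind_map_eq_map_compProd _ _ hF]
    refine Measure.bind_congr_right ?_
    filter_upwards [ae_of_ae_map measurable_fst.aemeasurable hK'] with p hp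
    rw [Kernel.comap_apply, hp]
  rw [h1, lintegral_map hf hF, Measure.lintegral_compProd (by fun_prop)]
  rfl

theorem inversionLaw_map_fst_snd {G X Y : Type*} [MeasurableSpace G] [MeasurableSpace X]
    [MeasurableSpace Y] {P : Measure (X × Y)} [IsProbabilityMeasure P] {K : X → Measure G}
    {K' : Kernel X G} [IsMarkovKernel K'] (hK' : ∀ᵐ x ∂P.fst, K' x = K x) :
    (inversionLaw P K).map (fun ω => (ω.1, ω.2.1)) = P.fst ⊗ₘ K' := by
  refine Measure.ext_of_lintegral _ fun f hf => ?_
  rw [lintegral_map hf (by fun_prop), lintegral_inversionLaw hK' (by fun_prop),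
    Measure.lintegral_compProd hf, Measure.fst, lintegral_map (by fun_prop) measurable_fst]

theorem inversionLaw_map_fst_snd_snd {G X Y : Type*} [MeasurableSpace G] [MeasurableSpace X]
    [MeasurableSpace Y] {P : Measure (X × Y)} [IsProbabilityMeasure P] {K : X → Measure G}
    {K' : Kernel X G} [IsMarkovKernel K'] (hK' : ∀ᵐ x ∂P.fst, K' x = K x) :
    (inversionLaw P K).map (fun ω => (ω.1, ω.2.2)) = P := by
  refine Measure.ext_of_lintegral _ fun f hf => ?_
  rw [lintegral_map hf (by fun_prop), lintegral_inversionLaw hK' (by fun_prop)]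
  simp

theorem ae_inversionLaw {G X Y : Type*} [MeasurableSpace G] [MeasurableSpace X]
    [MeasurableSpace Y] {P : Measure (X × Y)} [IsProbabilityMeasure P] {K : X → Measure G}
    {K' : Kernel X G} [IsMarkovKernel K'] (hK' : ∀ᵐ x ∂P.fst, K' x = K x) {p : X → Prop}
    (hp : ∀ᵐ x ∂P.fst, p x) : ∀ᵐ ω ∂(inversionLaw P K), p ω.1 := by
  refine ae_of_ae_map (f := Prod.fst) (by fun_prop) ?_
  have h : (inversionLaw P K).map Prod.fst = P.fst := by
    conv_rhs => rw [← inversionLaw_map_fst_snd_snd hK', Measure.fst, Measure.map_map measurable_fst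
      (by fun_prop)]
    rfl
  rwa [h]

/-- The data of the symmetrization problem, made Borel: `ρ'` and `K'` are a measurable map and a
Markov kernel that agree almost everywhere with `ρ` and `K`. -/
structure IsBorelVersion {G X Y : Type*} [Group G] [MeasurableSpace G] [MeasurableSpace X]
    [MeasurableSpace Y] [MulAction G X] (P : Measure (X × Y)) (ρ : X → X) (K : X → Measure G)
    (ρ' : X → X) (K' : Kernel X G) : Prop where
  markov : IsMarkovKernel K'
  measurable : Measurable ρ'
  selector_ae_eq : ρ =ᵐ[P.fst] ρ'
  kernel_ae_eq : ∀ᵐ x ∂P.fst, K' x = K x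
  inversion : ∀ᵐ x ∂P.fst, ∀ᵐ t ∂(K' x), t • ρ' x = x

/-- The joint law of `(ρ(X), Γ, Ỹ)`, where `Γ` and `Ỹ` are sampled from the group-orbit kernel and
from the centred kernel at `ρ(X)`, conditionally independently given `ρ(X)`. The Borel version `K'`
of the inversion kernel makes the group-orbit kernel a `Kernel`. -/
noncomputable def orbitLaw {G X Y : Type*} [Group G] [MeasurableSpace G] [MeasurableSpace X]
    [StandardBorelSpace X] [Nonempty X] [MeasurableSpace Y] [StandardBorelSpace Y] [Nonempty Y]
    [MulAction G Y] (P : Measure (X × Y)) [IsProbabilityMeasure P] (ρ : X → X)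
    (K : X → Measure G) [∀ x, IsProbabilityMeasure (K x)] (K' : Kernel X G) :
    Measure (X × G × Y) :=
  P.fst.map ρ ⊗ₘ ((K' ∘ₖ condDistrib (fun x : X => x) ρ P.fst) ×ₖ centredKernel P ρ K)

instance centredKernel.isMarkovKernel {G X Y : Type*} [Group G] [MeasurableSpace G]
    [MeasurableSpace X] [MeasurableSpace Y] [StandardBorelSpace Y] [Nonempty Y] [MulAction G Y]
    (P : Measure (X × Y)) [IsProbabilityMeasure P] (ρ : X → X) (K : X → Measure G)
    [∀ x, IsProbabilityMeasure (K x)] : IsMarkovKernel (centredKernel P ρ K) := by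
  unfold centredKernel
  infer_instance

section

variable {G X Y : Type*} [Group G] [MeasurableSpace G] [MeasurableSpace X] [MeasurableSpace Y]
  [MulAction G X] {P : Measure (X × Y)} [IsProbabilityMeasure P] {ρ : X → X} {K : X → Measure G}
  {ρ' : X → X} {K' : Kernel X G}

theorem groupOrbitKernel_ae_eq [StandardBorelSpace X] [Nonempty X]
    (hV : IsBorelVersion P ρ K ρ' K') :
    ∀ᵐ x ∂P.fst, groupOrbitKernel P.fst ρ K (ρ' x) =
      (K' ∘ₖ condDistrib (fun x : X => x) ρ P.fst) (ρ' x) := by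
  have hρ : AEMeasurable ρ P.fst := ⟨ρ', hV.measurable, hV.selector_ae_eq⟩
  have h1 : ∀ᵐ q ∂(P.fst.map ρ ⊗ₘ condDistrib (fun x : X => x) ρ P.fst), K' q.2 = K q.2 := by
    rw [compProd_map_condDistrib (by fun_prop)]
    refine ae_of_ae_map (f := fun q : X × X => q.2) (by fun_prop) ?_ (p := fun x => K' x = K x)
    rw [AEMeasurable.map_map_of_aemeasurable (by fun_prop) (hρ.prodMk (by fun_prop))]
    change ∀ᵐ x ∂(P.fst.map id), K' x = K x
    rw [Measure.map_id]
    exact hV.kernel_ae_eq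
  have h2 := Measure.ae_ae_of_ae_compProd h1
  rw [Measure.map_congr hV.selector_ae_eq] at h2
  filter_upwards [ae_of_ae_map hV.measurable.aemeasurable h2] with x hx
  rw [Kernel.comp_apply]
  exact Measure.bind_congr_right (hx.mono fun _ h => h.symm)

/-- The group-orbit kernel is the conditional distribution of `T` given `ρ(X)`. -/
theorem compProd_map_selector [StandardBorelSpace X] [Nonempty X]
    (hV : IsBorelVersion P ρ K ρ' K') :
    (P.fst ⊗ₘ K').map (fun q => (ρ' q.1, q.2)) =
      P.fst.map ρ ⊗ₘ (K' ∘ₖ condDistrib (fun x : X => x) ρ P.fst) := by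
  have := hV.markov
  have hρ := hV.measurable
  have h2 : P.fst.map ρ ⊗ₘ condDistrib (fun x : X => x) ρ P.fst =
      P.fst.map fun x => (ρ' x, x) := by
    rw [compProd_map_condDistrib (by fun_prop)]
    exact Measure.map_congr (hV.selector_ae_eq.mono fun x hx => by simp only [hx])
  refine Measure.ext_of_lintegral _ fun f hf => ?_
  have hg : Measurable fun q : X × X => ∫⁻ t, f (q.1, t) ∂(K' q.2) := by
    have h3 : Measurable fun q : (X × X) × G => f (q.1.1, q.2) := by fun_prop
    exact h3.lintegral_kernel_prod_right' (κ := K'.comap Prod.snd measurable_snd)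
  rw [lintegral_map hf (by fun_prop), Measure.lintegral_compProd (by fun_prop),
    Measure.lintegral_compProd hf]
  have h4 := lintegral_map (μ := P.fst) hg (g := fun x => (ρ' x, x)) (by fun_prop)
  rw [← h2, Measure.lintegral_compProd hg] at h4
  rw [← h4]
  refine lintegral_congr fun r => ?_
  rw [Kernel.lintegral_comp _ _ _ (by fun_prop)]

theorem inversionLaw_map_selector_group [StandardBorelSpace X] [Nonempty X]
    (hV : IsBorelVersion P ρ K ρ' K') :
    (inversionLaw P K).map (fun ω => (ρ' ω.1, ω.2.1)) =
      P.fst.map ρ ⊗ₘ (K' ∘ₖ condDistrib (fun x : X => x) ρ P.fst) := by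
  have := hV.markov
  have hρ := hV.measurable
  rw [← compProd_map_selector hV, ← inversionLaw_map_fst_snd hV.kernel_ae_eq,
    Measure.map_map (by fun_prop) (by fun_prop)]
  rfl

theorem aemeasurable_selector_inversionLaw (hV : IsBorelVersion P ρ K ρ' K') :
    AEMeasurable (fun ω => ρ ω.1) (inversionLaw P K) := by
  have := hV.markov
  exact ⟨fun ω => ρ' ω.1, hV.measurable.comp measurable_fst,
    ae_inversionLaw hV.kernel_ae_eq hV.selector_ae_eq⟩

theorem inversionLaw_map_selector (hV : IsBorelVersion P ρ K ρ' K') :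
    (inversionLaw P K).map (fun ω => ρ ω.1) = P.fst.map ρ := by
  have := hV.markov
  have hρ := hV.measurable
  have h2 : (inversionLaw P K).map (fun ω => ρ ω.1) =
      (inversionLaw P K).map (fun ω => ρ' ω.1) :=
    Measure.map_congr (ae_inversionLaw hV.kernel_ae_eq hV.selector_ae_eq)
  rw [h2, Measure.map_congr hV.selector_ae_eq, ← Measure.fst_compProd P.fst K',
    Measure.fst, Measure.map_map hρ measurable_fst,
    ← inversionLaw_map_fst_snd hV.kernel_ae_eq, Measure.map_map (by fun_prop) (by fun_prop)]
  rfl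

theorem inversionLaw_map_selector_centred [MeasurableInv G] [StandardBorelSpace Y] [Nonempty Y]
    [MulAction G Y] [MeasurableSMul₂ G Y] [∀ x, IsProbabilityMeasure (K x)]
    (hV : IsBorelVersion P ρ K ρ' K') :
    (inversionLaw P K).map (fun ω => (ρ' ω.1, ω.2.1⁻¹ • ω.2.2)) =
      P.fst.map ρ ⊗ₘ centredKernel P ρ K := by
  have := hV.markov
  have hm : Measurable fun ω : X × G × Y => ω.2.1⁻¹ • ω.2.2 :=
    (measurable_fst.comp measurable_snd).inv.smul (measurable_snd.comp measurable_snd)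
  rw [← inversionLaw_map_selector hV, centredKernel, compProd_map_condDistrib hm.aemeasurable]
  refine Measure.map_congr ?_
  filter_upwards [ae_inversionLaw hV.kernel_ae_eq hV.selector_ae_eq] with ω hω
  rw [hω]

theorem ae_smul_selector_inversionLaw [StandardBorelSpace X] [MeasurableSMul₂ G X]
    (hV : IsBorelVersion P ρ K ρ' K') :
    ∀ᵐ ω ∂(inversionLaw P K), ω.2.1 • ρ' ω.1 = ω.1 := by
  have := hV.markov
  have hρ := hV.measurable
  refine ae_of_ae_map (f := fun ω : X × G × Y => (ω.1, ω.2.1)) (by fun_prop) ?_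
    (p := fun q : X × G => q.2 • ρ' q.1 = q.1)
  rw [inversionLaw_map_fst_snd hV.kernel_ae_eq, Measure.ae_compProd_iff]
  · exact hV.inversion
  · exact measurableSet_eq_fun (measurable_snd.smul (hρ.comp measurable_fst)) measurable_fst

end

/-! ### The three identities in terms of the law of `(ρ(X), T, Ỹ)` -/

section

variable {G X Y : Type*} [Group G] [MeasurableSpace G]
  [MeasurableSpace X] [StandardBorelSpace X] [Nonempty X]
  [MeasurableSpace Y] [StandardBorelSpace Y] [Nonempty Y]
  [MulAction G X] [MulAction G Y] [MeasurableSMul₂ G Y]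
  {P : Measure (X × Y)} [IsProbabilityMeasure P] {ρ : X → X} {K : X → Measure G}
  [∀ x, IsProbabilityMeasure (K x)] {ρ' : X → X} {K' : Kernel X G}

/-- If `P = P_X ⊗ κ` with `κ` equivariant, then given `(X, T)` the variable `T⁻¹ • Y` has law
`κ (T⁻¹ • X) = κ (ρ(X))`: it is conditionally independent of `T` given `ρ(X)`, and `κ` is a version
of the centred kernel. -/
theorem inversionLaw_map_eq_orbitLaw [MeasurableInv G]
    (hV : IsBorelVersion P ρ K ρ' K') {κ : Kernel X Y}
    [IsMarkovKernel κ] (hP : P = P.fst ⊗ₘ κ) (hκ : IsEquivariantKernel G κ) :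
    (inversionLaw P K).map (fun ω => (ρ' ω.1, ω.2.1, ω.2.1⁻¹ • ω.2.2)) =
      orbitLaw P ρ K K' := by
  have := hV.markov
  have hρ := hV.measurable
  have hm : Measurable fun ω : X × G × Y => ω.2.1⁻¹ • ω.2.2 :=
    (measurable_fst.comp measurable_snd).inv.smul (measurable_snd.comp measurable_snd)
  have hκmap : ∀ (g : G) x, (κ (g • x)).map (g⁻¹ • ·) = κ x := by
    intro g x
    ext B hB
    rw [Measure.map_apply (measurable_const_smul _) hB, Set.preimage_smul, inv_inv,
      ← hκ g x B hB]
  let Γ := K' ∘ₖ condDistrib (fun x : X => x) ρ P.fst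
  have hS : (inversionLaw P K).map (fun ω => (ρ' ω.1, ω.2.1, ω.2.1⁻¹ • ω.2.2)) =
      P.fst.map ρ ⊗ₘ (Γ ×ₖ κ) := by
    refine Measure.ext_of_lintegral _ fun f hf => ?_
    have hf1 : Measurable fun ω : X × G × Y => f (ρ' ω.1, ω.2.1, ω.2.1⁻¹ • ω.2.2) := by fun_prop
    have hf2 : Measurable fun p : X × Y => ∫⁻ t, f (ρ' p.1, t, t⁻¹ • p.2) ∂(K' p.1) := by
      have h3 : Measurable fun q : (X × Y) × G => f (ρ' q.1.1, q.2, q.2⁻¹ • q.1.2) :=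
        hf1.comp (show Measurable fun q : (X × Y) × G => (q.1.1, q.2, q.1.2) by fun_prop)
      exact h3.lintegral_kernel_prod_right' (κ := K'.comap Prod.fst measurable_fst)
    have hρ2 : Measurable fun q : X × G => (ρ' q.1, q.2) := by fun_prop
    have hf4 : Measurable fun p : X × G => ∫⁻ y, f (p.1, p.2, y) ∂(κ p.1) := by
      have h3 : Measurable fun q : (X × G) × Y => f (q.1.1, q.1.2, q.2) := by fun_prop
      exact h3.lintegral_kernel_prod_right' (κ := κ.comap Prod.fst measurable_fst)
    have hf5 : Measurable fun q : X × G => ∫⁻ y, f (ρ' q.1, q.2, y) ∂(κ (ρ' q.1)) := hf4.comp hρ2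
    rw [lintegral_map hf (by fun_prop), lintegral_inversionLaw hV.kernel_ae_eq hf1,
      lintegral_compProd_prod _ _ _ hf, ← compProd_map_selector hV,
      lintegral_map hf4 hρ2, Measure.lintegral_compProd hf5]
    conv_lhs => rw [hP]
    rw [Measure.lintegral_compProd hf2]
    refine lintegral_congr_ae ?_
    filter_upwards [hV.inversion] with x hx
    -- `T` and `Y` are conditionally independent given `X`, so either may be integrated first.
    rw [lintegral_lintegral_swap]
    · refine lintegral_congr_ae ?_
      filter_upwards [hx] with t ht
      rw [← hκmap t (ρ' x), ht, lintegral_map (by fun_prop) (measurable_const_smul _)]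
    · exact (hf1.comp (show Measurable fun q : Y × G => (x, q.2, q.1) by fun_prop)).aemeasurable
  -- Forgetting `T` identifies `κ` with the conditional distribution of `Ỹ` given `ρ(X)`.
  have hQ : centredKernel P ρ K =ᵐ[P.fst.map ρ] κ := by
    refine Kernel.ae_eq_of_compProd_eq ?_
    rw [← inversionLaw_map_selector_centred hV]
    have h1 := congrArg (Measure.map fun q : X × G × Y => (q.1, q.2.2)) hS
    rw [Measure.map_map (by fun_prop) (by fun_prop)] at h1
    refine Eq.trans h1 ?_
    refine (Measure.compProd_map measurable_snd).symm.trans ?_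
    rw [← Kernel.snd_eq, Kernel.snd_prod]
  rw [hS, orbitLaw]
  refine Measure.compProd_congr ?_
  filter_upwards [hQ] with r hr
  rw [Kernel.prod_apply, Kernel.prod_apply, hr]

variable [MeasurableSMul₂ G X]

theorem identityE1_iff [MeasurableInv G]
    (hV : IsBorelVersion P ρ K ρ' K') :
    IdentityE1 P ρ K ↔
      (inversionLaw P K).map (fun ω => (ρ ω.1, ω.2.1⁻¹ • ω.2.2, ω.1, ω.2.2)) =
        (orbitLaw P ρ K K').map fun q => (q.1, q.2.2, q.2.1 • q.1, q.2.1 • q.2.2) := by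
  have := hV.markov
  have hρ := hV.measurable
  have hm : Measurable fun ω : X × G × Y => ω.2.1⁻¹ • ω.2.2 :=
    (measurable_fst.comp measurable_snd).inv.smul (measurable_snd.comp measurable_snd)
  have hF : Measurable fun q : X × Y × G => (q.1, q.2.1, q.2.2 • q.1, q.2.2 • q.2.1) := by
    fun_prop
  have h1 := bind_resample (L := inversionLaw P K) (by fun_prop)
    (inversionLaw_map_selector_centred hV)
    (K' ∘ₖ condDistrib (fun x : X => x) ρ P.fst) hF
  rw [← compProd_prod_map_swap, Measure.map_map hF (by fun_prop)] at h1
  refine Iff.of_eq (congrArg _ (Eq.trans ?_ h1))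
  refine Measure.bind_congr_right ?_
  filter_upwards [ae_inversionLaw hV.kernel_ae_eq hV.selector_ae_eq,
    ae_inversionLaw hV.kernel_ae_eq (groupOrbitKernel_ae_eq hV)] with ω h2 h3
  rw [h2, h3]

theorem identityE2_iff (hV : IsBorelVersion P ρ K ρ' K') :
    IdentityE2 P ρ K ↔
      (inversionLaw P K).map (fun ω => (ρ ω.1, ω.2.1, ω.1, ω.2.2)) =
        (orbitLaw P ρ K K').map fun q => (q.1, q.2.1, q.2.1 • q.1, q.2.1 • q.2.2) := by
  have := hV.markov
  have hρ := hV.measurable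
  have hF : Measurable fun q : X × G × Y => (q.1, q.2.1, q.2.1 • q.1, q.2.1 • q.2.2) := by
    fun_prop
  have h1 := bind_resample (L := inversionLaw P K) (by fun_prop)
    (inversionLaw_map_selector_group hV) (centredKernel P ρ K) hF
  refine Iff.of_eq (congrArg _ (Eq.trans ?_ h1))
  refine Measure.bind_congr_right ?_
  filter_upwards [ae_inversionLaw hV.kernel_ae_eq hV.selector_ae_eq] with ω h2
  rw [h2]

theorem identityE3_iff (hV : IsBorelVersion P ρ K ρ' K') :
    IdentityE3 P ρ K ↔
      (inversionLaw P K).map (fun ω => (ρ ω.1, ω.1, ω.2.2)) =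
        (orbitLaw P ρ K K').map fun q => (q.1, q.2.1 • q.1, q.2.1 • q.2.2) := by
  have := hV.markov
  have hρ := hV.measurable
  have hF : Measurable fun q : X × G × Y => (q.1, q.2.1 • q.1, q.2.1 • q.2.2) := by
    fun_prop
  have h1 : (P.fst.bind fun x =>
      ((groupOrbitKernel P.fst ρ K (ρ x)).prod (centredKernel P ρ K (ρ x))).map
        fun z : G × Y => (ρ x, z.1 • ρ x, z.1 • z.2)) =
      (orbitLaw P ρ K K').map fun q => (q.1, q.2.1 • q.1, q.2.1 • q.2.2) := by
    rw [orbitLaw, ← bind_map_eq_map_compProd _ _ hF, Measure.map_congr hV.selector_ae_eq,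
      ← bind_comp_eq_bind_map hρ.aemeasurable (measurable_map_prodMk _ hF)]
    refine Measure.bind_congr_right ?_
    filter_upwards [hV.selector_ae_eq, groupOrbitKernel_ae_eq hV] with x h2 h3
    rw [h2, h3, Kernel.prod_apply]
  have h2 : P.map (fun p : X × Y => (ρ p.1, p.1, p.2)) =
      (inversionLaw P K).map (fun ω => (ρ ω.1, ω.1, ω.2.2)) := by
    have h3 : P.map (fun p : X × Y => (ρ p.1, p.1, p.2)) =
        P.map (fun p : X × Y => (ρ' p.1, p.1, p.2)) :=
      Measure.map_congr ((ae_of_ae_map measurable_fst.aemeasurable hV.selector_ae_eq).mono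
        fun p hp => by simp only [hp])
    have h4 : (inversionLaw P K).map (fun ω => (ρ ω.1, ω.1, ω.2.2)) =
        (inversionLaw P K).map (fun ω => (ρ' ω.1, ω.1, ω.2.2)) :=
      Measure.map_congr ((ae_inversionLaw hV.kernel_ae_eq hV.selector_ae_eq).mono
        fun p hp => by simp only [hp])
    rw [h3, h4]
    conv_lhs => rw [← inversionLaw_map_fst_snd_snd (P := P) hV.kernel_ae_eq,
      Measure.map_map (by fun_prop) (by fun_prop)]
    rfl
  rw [IdentityE3, h1, h2]

theorem identityE3_of_identityE1 [MeasurableInv G]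
    (hV : IsBorelVersion P ρ K ρ' K') (h : IdentityE1 P ρ K) :
    IdentityE3 P ρ K := by
  have hρ := aemeasurable_selector_inversionLaw hV
  rw [identityE1_iff hV] at h
  have hg : Measurable fun q : X × Y × X × Y => (q.1, q.2.2.1, q.2.2.2) := by fun_prop
  have hm : Measurable fun ω : X × G × Y => ω.2.1⁻¹ • ω.2.2 :=
    (measurable_fst.comp measurable_snd).inv.smul (measurable_snd.comp measurable_snd)
  have h1 := congrArg (Measure.map fun q : X × Y × X × Y => (q.1, q.2.2.1, q.2.2.2)) h
  rw [AEMeasurable.map_map_of_aemeasurable hg.aemeasurable (hρ.prodMk (by fun_prop)),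
    Measure.map_map hg (by fun_prop)] at h1
  exact (identityE3_iff hV).2 h1

theorem identityE3_of_identityE2 (hV : IsBorelVersion P ρ K ρ' K') (h : IdentityE2 P ρ K) :
    IdentityE3 P ρ K := by
  have hρ := aemeasurable_selector_inversionLaw hV
  rw [identityE2_iff hV] at h
  have hg : Measurable fun q : X × G × X × Y => (q.1, q.2.2.1, q.2.2.2) := by fun_prop
  have h1 := congrArg (Measure.map fun q : X × G × X × Y => (q.1, q.2.2.1, q.2.2.2)) h
  rw [AEMeasurable.map_map_of_aemeasurable hg.aemeasurable (hρ.prodMk (by fun_prop)),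
    Measure.map_map hg (by fun_prop)] at h1
  exact (identityE3_iff hV).2 h1

/-- Since `T • ρ(X) = X` and `T • Ỹ = Y`, the first two identities follow once `(ρ(X), T, Ỹ)` has
the law of `(ρ(X), Γ, Ỹ)`, that is, once `T` and `Ỹ` are conditionally independent given
`ρ(X)`. -/
theorem identityE1_and_identityE2_of_map_eq_orbitLaw [MeasurableInv G]
    (hV : IsBorelVersion P ρ K ρ' K')
    (h : (inversionLaw P K).map (fun ω => (ρ' ω.1, ω.2.1, ω.2.1⁻¹ • ω.2.2)) =
      orbitLaw P ρ K K') :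
    IdentityE1 P ρ K ∧ IdentityE2 P ρ K := by
  have := hV.markov
  have hρ := hV.measurable
  have hm : Measurable fun ω : X × G × Y => ω.2.1⁻¹ • ω.2.2 :=
    (measurable_fst.comp measurable_snd).inv.smul (measurable_snd.comp measurable_snd)
  rw [identityE1_iff hV, identityE2_iff hV, ← h, Measure.map_map (by fun_prop) (by fun_prop),
    Measure.map_map (by fun_prop) (by fun_prop)]
  constructor <;>
  · refine Measure.map_congr ?_
    filter_upwards [ae_inversionLaw hV.kernel_ae_eq hV.selector_ae_eq,
      ae_smul_selector_inversionLaw hV] with ω h1 h2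
    simp only [Function.comp_apply, h1, h2, smul_inv_smul]

/-- The third identity says that given `X` the law of `Y` is that of `T • Y'`, with `T ∼ K X` and
`Y'` sampled from the centred kernel at `ρ(X)`. -/
theorem eq_compProd_of_identityE3 (hV : IsBorelVersion P ρ K ρ' K') (h : IdentityE3 P ρ K) :
    P = P.fst ⊗ₘ (K' ×ₖ (centredKernel P ρ K).comap ρ' hV.measurable).map
      fun z : G × Y => z.1 • z.2 := by
  have := hV.markov
  have hρ := hV.measurable
  have hρL := aemeasurable_selector_inversionLaw hV
  have hsm : Measurable fun z : G × Y => z.1 • z.2 := by fun_prop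
  rw [identityE3_iff hV] at h
  have h1 := congrArg (Measure.map fun q : X × X × Y => q.2) h
  rw [AEMeasurable.map_map_of_aemeasurable (by fun_prop) (hρL.prodMk (by fun_prop)),
    Measure.map_map (by fun_prop) (by fun_prop)] at h1
  have h2 := (inversionLaw_map_fst_snd_snd (P := P) (K := K) hV.kernel_ae_eq).symm.trans h1
  refine h2.trans (Measure.ext_of_lintegral _ fun f hf => ?_)
  have hρ2 : Measurable fun q : X × G => (ρ' q.1, q.2) := by fun_prop
  have hf4 : Measurable fun p : X × G =>
      ∫⁻ y, f (p.2 • p.1, p.2 • y) ∂(centredKernel P ρ K p.1) := by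
    have h3 : Measurable fun q : (X × G) × Y => f (q.1.2 • q.1.1, q.1.2 • q.2) := by fun_prop
    exact h3.lintegral_kernel_prod_right'
      (κ := (centredKernel P ρ K).comap Prod.fst measurable_fst)
  have hf5 : Measurable fun q : X × G =>
      ∫⁻ y, f (q.2 • ρ' q.1, q.2 • y) ∂(centredKernel P ρ K (ρ' q.1)) := hf4.comp hρ2
  rw [lintegral_map hf (by fun_prop)]
  refine (lintegral_compProd_prod (f := fun q : X × G × Y => f (q.2.1 • q.1, q.2.1 • q.2.2))
    _ _ _ (by fun_prop)).trans ?_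
  rw [← compProd_map_selector hV,
    lintegral_map hf4 hρ2, Measure.lintegral_compProd hf5,
    Measure.lintegral_compProd hf]
  refine lintegral_congr_ae ?_
  filter_upwards [hV.inversion] with x hx
  rw [Kernel.lintegral_map _ hsm _ (by fun_prop), Kernel.lintegral_prod _ _ _ (by fun_prop)]
  refine lintegral_congr_ae ?_
  filter_upwards [hx] with t ht
  simp only [ht, Kernel.comap_apply]

end

/-! ### The converse -/

theorem exists_isBorelVersion {G X Y : Type*} [Group G] [MeasurableSpace G]
    [MeasurableSpace X] [Nonempty X] [MeasurableSpace Y] [MulAction G X]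
    (P : Measure (X × Y)) {ρ : X → X} (hρm : AEMeasurable ρ P.fst) {K : X → Measure G}
    [∀ x, IsProbabilityMeasure (K x)] (hK : IsInversionKernel P.fst ρ K) :
    ∃ ρ' K', IsBorelVersion P ρ K ρ' K' := by
  obtain ⟨K', hM, hK'⟩ := exists_markovKernel_ae_eq hK.aemeasurable
  refine ⟨hρm.mk ρ, K', hM, hρm.measurable_mk, hρm.ae_eq_mk, hK', ?_⟩
  filter_upwards [hK', hρm.ae_eq_mk] with x hx hx'
  rw [hx, ← hx']
  exact hK.inversion x

/-- The law of `T • Y'` given `X` is equivariant at every point because `K` is and `ρ` is invariant,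
but it is only almost everywhere measurable; properness of the action supplies a Markov kernel. -/
theorem isEquivariantCondDistrib_of_identityE3 {G X Y : Type*}
    [Group G] [TopologicalSpace G] [IsTopologicalGroup G] [LocallyCompactSpace G]
    [SecondCountableTopology G] [T2Space G] [MeasurableSpace G] [BorelSpace G]
    [MeasurableSpace X] [StandardBorelSpace X] [Nonempty X]
    [MeasurableSpace Y] [StandardBorelSpace Y] [Nonempty Y]
    [MulAction G X] [MeasurableSMul₂ G X] [MulAction G Y] [MeasurableSMul₂ G Y]
    (hproper : IsProperAction G X) {P : Measure (X × Y)} [IsProbabilityMeasure P]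
    {ρ : X → X} (hρ : IsOrbitSelector G ρ) {K : X → Measure G} [∀ x, IsProbabilityMeasure (K x)]
    (hK : IsInversionKernel P.fst ρ K) {ρ' : X → X} {K' : Kernel X G}
    (hV : IsBorelVersion P ρ K ρ' K') (h : IdentityE3 P ρ K) :
    IsEquivariantCondDistrib G P := by
  have := hV.markov
  have hsm : Measurable fun z : G × Y => z.1 • z.2 := by fun_prop
  let κ' : X → Measure Y := fun x =>
    ((K x).prod (centredKernel P ρ K (ρ x))).map fun z : G × Y => z.1 • z.2
  have : ∀ x, IsProbabilityMeasure (κ' x) :=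
    fun x => Measure.isProbabilityMeasure_map hsm.aemeasurable
  have hae : ∀ᵐ x ∂P.fst, κ' x =
      (K' ×ₖ (centredKernel P ρ K).comap ρ' hV.measurable).map (fun z : G × Y => z.1 • z.2) x := by
    filter_upwards [hV.kernel_ae_eq, hV.selector_ae_eq] with x h1 h2
    rw [Kernel.map_apply _ hsm, Kernel.prod_apply, h1, Kernel.comap_apply, ← h2]
  have hm : AEMeasurable κ' P.fst := ⟨_, Kernel.measurable _, hae⟩
  have heq : ∀ (g : G) x, κ' (g • x) = (κ' x).map (g • ·) := by
    intro g x
    have hKg : K (g • x) = (K x).map (g • ·) := by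
      ext B hB
      rw [hK.equivariant g x B hB, Measure.map_apply (measurable_const_smul g) hB,
        Set.preimage_smul]
    have h1 := Measure.map_prod_map (K x) (centredKernel P ρ K (ρ x))
      (measurable_const_smul g) measurable_id
    rw [Measure.map_id] at h1
    simp only [κ', hρ.smul_eq, hKg]
    rw [h1, Measure.map_map hsm (by fun_prop), Measure.map_map (measurable_const_smul g) hsm]
    congr 1
    funext z
    simp [mul_smul]
  obtain ⟨κ, hκM, hκe, hκ⟩ := exists_equivariantKernel_ae_eq hproper hm heq
  refine ⟨κ, hκM, ?_, hκe⟩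
  conv_lhs => rw [eq_compProd_of_identityE3 hV h]
  refine Measure.compProd_congr ?_
  filter_upwards [hae, hκ] with x h1 h2
  rw [← h1, h2]

theorem mainTheorem2 {G X Y : Type*}
    [Group G] [TopologicalSpace G] [IsTopologicalGroup G] [LocallyCompactSpace G]
    [SecondCountableTopology G] [T2Space G] [MeasurableSpace G] [BorelSpace G]
    [TopologicalSpace X] [MeasurableSpace X] [BorelSpace X] [StandardBorelSpace X] [Nonempty X]
    [TopologicalSpace Y] [MeasurableSpace Y] [BorelSpace Y] [StandardBorelSpace Y] [Nonempty Y]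
    [MulAction G X] [ContinuousSMul G X] [MulAction G Y] [ContinuousSMul G Y]
    (hproper : IsProperAction G X)
    (P : Measure (X × Y)) [IsProbabilityMeasure P]
    (ρ : X → X) (hρ : IsOrbitSelector G ρ) (hρm : AEMeasurable ρ P.fst)
    (K : X → Measure G) [∀ x, IsProbabilityMeasure (K x)] (hK : IsInversionKernel P.fst ρ K) :
    (IsEquivariantCondDistrib G P ↔ IdentityE1 P ρ K) ∧
    (IsEquivariantCondDistrib G P ↔ IdentityE2 P ρ K) ∧
    (IsEquivariantCondDistrib G P ↔ IdentityE3 P ρ K) := 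
by
  obtain ⟨ρ', K', hV⟩ := exists_isBorelVersion P hρm hK
  have h12 : IsEquivariantCondDistrib G P → IdentityE1 P ρ K ∧ IdentityE2 P ρ K := by
    rintro ⟨κ, _, hP, hκ⟩
    exact identityE1_and_identityE2_of_map_eq_orbitLaw hV
      (inversionLaw_map_eq_orbitLaw hV hP hκ)
  have h3 : IdentityE3 P ρ K → IsEquivariantCondDistrib G P :=
    isEquivariantCondDistrib_of_identityE3 hproper hρ hK hV
  exact ⟨⟨fun h => (h12 h).1, fun h => h3 (identityE3_of_identityE1 hV h)⟩,
    ⟨fun h => (h12 h).2, fun h => h3 (identityE3_of_identityE2 hV h)⟩,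
    ⟨fun h => identityE3_of_identityE1 hV (h12 h).1, h3⟩⟩
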